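/- A randomized one-pass streaming algorithm reads a stream $e_1,\dots,e_m$ of undirected edges on the vertex set $V$ with $|V|=n\ge 1$ (insertions only, in arbitrary order, repeated edges and self-loops allowed, $m$ not known in advance). After the stream it receives a vertex $v_0$ and outputs a walk $(v_0,v_1,\dots,v_t)\in V^{t+1}$, one vertex after the other; its memory is counted while it reads the stream and between the outputs, and the output itself is not counted. A word is a memory cell of $O(\log_2\max\{2,n,m\})$ bits. Let $f(u,v)$ be the number of occurrences of the edge $\{u,v\}$ in the stream, let $d(u)=\sum_{v\in V} f(u,v)$, and let $$\mathcal{RW}_{v_0,t}(w_0,\dots,w_t)=\mathbf 1[w_0=v_0]\prod_{i=0}^{t-1}\frac{f(w_i,w_{i+1})}{d(w_i)}$$ be the law of the $t$-step random walk started at $v_0$. Theorem. For all $n\ge1$, $t\ge 1$ and $0<\varepsilon\le 1$ there is such an algorithm (depending only on $n$, $t$ and $\varepsilon$) which, for every stream and every start vertex $v_0$ with $d(v_0)>0$, outputs a walk whose law $P$ satisfies $\sum_{w\in V^{t+1}}|P(w)-\mathcal{RW}_{v_0,t}(w)|\le\varepsilon$, and which uses $$O\!\left(n\sqrt t\cdot\frac{q}{\log_2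 q}\right)\ \text{words of memory},\qquad q=2+\frac{\log_2(1/\varepsilon)}{\sqrt t},$$ with an absolute implied constant. In particular, the algorithm uses $O(n\sqrt t)$ words of memory when $\varepsilon=2^{-\Theta(\sqrt t)}$; more precisely, for every constant $b$ it uses $O_b(n\sqrt t)$ words whenever $2^{-b\sqrt t}\le\varepsilon\le 1$. -/

import Mathlib

noncomputable section

/-- The multiplicity `f(u, v)` of the undirected edge `{u, v}` in the multigraph on the vertex set
`Fin n` given by the stream `es`: the number of occurrences of the edge in the stream
(self-loops are allowed). -/
def edgeMult {n : ℕ} (es : List (Sym2 (Fin n))) (u v : Fin n) : ℕ :=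
  es.count s(u, v)

/-- The degree `d(u) = ∑ v, f(u, v)`. -/
def vertexDegree {n : ℕ} (es : List (Sym2 (Fin n))) (u : Fin n) : ℕ :=
  ∑ v, edgeMult es u v

/-- The law of the `t`-step random walk from `s` on the multigraph given by `es`:
`RW(w) = 1[w 0 = s] * ∏ i < t, f(w i, w (i+1)) / d(w i)`. -/
def randomWalkLaw {n : ℕ} (es : List (Sym2 (Fin n))) (s : Fin n) (t : ℕ)
    (w : Fin (t + 1) → Fin n) : ℝ :=
  if w 0 = s then
    ∏ i : Fin t, (edgeMult es (w i.castSucc) (w i.succ) : ℝ) / vertexDegree es (w i.castSucc)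
  else 0

/-- A randomized one-pass algorithm for insertion-only streams of undirected edges on the vertex
set `Fin n`, with a memory of `S` words (natural numbers; their length is bounded in
`WordsBounded`). The memory content is all that the algorithm remembers, both while it reads the
stream and while it answers the query; every transition draws fresh randomness. -/
structure WalkStreamAlg (n S : ℕ) where
  /-- the initial memory -/
  init : Fin S → ℕ
  /-- how the memory changes when the next edge of the stream is read -/
  update : (Fin S → ℕ) → Sym2 (Fin n) → PMF (Fin S → ℕ)
  /-- how the memory changes when the start vertex of the walk is received after the stream -/
  query : (Fin S → ℕ) → Fin n → PMF (Fin S → ℕ)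
  /-- output the next vertex of the walk on a write-only output, and change the memory -/
  step : (Fin S → ℕ) → PMF (Fin n × (Fin S → ℕ))

namespace WalkStreamAlg

variable {n S : ℕ}

/-- The law of the memory after reading the stream `es` from the memory content `M`. -/
def readFrom (A : WalkStreamAlg n S) : List (Sym2 (Fin n)) → (Fin S → ℕ) → PMF (Fin S → ℕ)
  | [], M => PMF.pure M
  | e :: es, M => (A.update M e).bind (A.readFrom es)

/-- The joint law of the next `k` output vertices and of the memory after they were output. -/
def emit (A : WalkStreamAlg n S) : (k : ℕ) → (Fin S → ℕ) →
    PMF ((Fin k → Fin n) × (Fin S → ℕ))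
  | 0, M => PMF.pure (Fin.elim0, M)
  | k + 1, M => (A.step M).bind fun x =>
      (A.emit k x.2).map fun y => (Fin.cons x.1 y.1, y.2)

/-- The joint law of the output `(s, v₁, …, v_k)` and of the memory after the stream `es` was read,
the start vertex `s` was received, and `k` steps of the walk were output. -/
def run (A : WalkStreamAlg n S) (es : List (Sym2 (Fin n))) (s : Fin n) (k : ℕ) :
    PMF ((Fin (k + 1) → Fin n) × (Fin S → ℕ)) :=
  ((A.readFrom es A.init).bind fun M => (A.query M s).bind (A.emit k)).map
    fun y => (Fin.cons s y.1, y.2)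

/-- The law of the walk that is output. -/
def output (A : WalkStreamAlg n S) (es : List (Sym2 (Fin n))) (s : Fin n) (t : ℕ) :
    PMF (Fin (t + 1) → Fin n) :=
  (A.run es s t).map Prod.fst

/-- Every memory word has at most `c * log₂ (max {2, n, m})` bits, that is, it is smaller than
`(max {2, n, m}) ^ c`, at every time: after any stream of `m` edges, and from then on during the
output of a `t`-step walk from any start vertex. The length of the stream is not
known to the algorithm in advance. -/
def WordsBounded (A : WalkStreamAlg n S) (t c : ℕ) : Prop :=
  ∀ es : List (Sym2 (Fin n)),
    (∀ M ∈ (A.readFrom es A.init).support, ∀ i, M i < (max 2 (max n es.length)) ^ c) ∧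
    ∀ s : Fin n, ∀ k ≤ t, ∀ y ∈ (A.run es s k).support,
      ∀ i, y.2 i < (max 2 (max n es.length)) ^ c

/-- For every stream and every start vertex of positive degree, the law of the output is within
`ℓ₁` distance `ε` of the law of the `t`-step random walk. -/
def SimulatesWithin (A : WalkStreamAlg n S) (t : ℕ) (ε : ℝ) : Prop :=
  ∀ (es : List (Sym2 (Fin n))) (s : Fin n), 0 < vertexDegree es s →
    ∑ w : Fin (t + 1) → Fin n, |(A.output es s t w).toReal - randomWalkLaw es s t w| ≤ ε

end WalkStreamAlg

/-- `q = 2 + log₂ (1 / ε) / √t`. -/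
def qParam (t : ℕ) (ε : ℝ) : ℝ := 2 + Real.logb 2 (1 / ε) / √(t : ℝ)

end

/-!
Every vertex `u` keeps a table of at most `C` counters of incident edges, maintained by the frequent
elements algorithm of Misra and Gries, its degree, and `C` random samples. An edge `{u, v}` counts as
*stored* as often as the larger of its counters in the tables of `u` and `v` says; the other copies
are *residual*. Reading an edge never turns a residual copy into a stored one, so the samples of `u`
can be kept uniform among the residual copies at `u` by reservoir sampling
(`PMF.sampleLaw_bind_reservoirStep`, `readFrom_walkAlg`). After the stream, a step from `u` is drawn
from the stored copies, which are known exactly, or else it uses up one of the samples of `u`. So the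
output follows the random walk until some vertex has been left by more than `C` residual steps
(`budgetedWalk_le_mean_walkLaw`, `budgetedWalk_le_randomWalkLaw`), and the distance of the laws is at
most twice the probability of this overflow.

The overflow is rare because the graph is undirected. Misra and Gries give
`r(u, v) ≤ d(v) / (C + 1)` for the residual multiplicity `r`, with the degree of the *other* end
(`Summary.mul_residual_le`); this is where the tables of both ends are needed. With the reversibility
`d(v) P^i(v, u) = d(u) P^i(u, v)` it follows that
`∑ v, r(u, v) / d(u) * P^i(v, u) ≤ 1 / (C + 1)` for every `i` (`sum_residual_mul_pow_le`): each
prescribed time of return after a residual step from `u` costs a factor `1 / (C + 1)`. A sum over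
all sets of `C + 1` times at which the walk makes residual steps from one vertex, where the first
time costs nothing even when summed over all vertices, bounds the probability of an overflow in `t`
steps by `t.choose (C + 1) / (C + 1) ^ C` (`one_sub_sum_budgetedWalk_const_le`). For
`C` of the order of `√t * q / log₂ q` this is at most `ε / 2` (`two_mul_choose_div_le_of_le`).
-/

noncomputable section

/-! ### Random walks with a budget of residual steps -/

section BudgetedWalk

variable {V : Type*} [Fintype V]

theorem Fin.sum_univ_pi_succ {M : Type*} [AddCommMonoid M] {T : ℕ} (F : (Fin (T + 1) → V) → M) :
    ∑ w, F w = ∑ v, ∑ w : Fin T → V, F (Fin.cons v w) := by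
  rw [← Fintype.sum_prod_type']
  exact (Fintype.sum_equiv (Fin.consEquiv fun _ : Fin (T + 1) => V) _ _ fun _ => rfl).symm
/-- The transition matrix `P u v = f u v / ∑ w, f u w` of the random walk with edge weights `f`. -/
def transitionMatrix (f : V → V → ℝ) : Matrix V V ℝ :=
  Matrix.of fun u v => f u v / ∑ w, f u w

theorem transitionMatrix_apply (f : V → V → ℝ) (u v : V) :
    transitionMatrix f u v = f u v / ∑ w, f u w := rfl

theorem sum_transitionMatrix_le_one (f : V → V → ℝ) (u : V) : ∑ v, transitionMatrix f u v ≤ 1 := by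
  simp only [transitionMatrix_apply, ← Finset.sum_div]
  exact div_self_le_one _

variable [DecidableEq V]

theorem transitionMatrix_pow_nonneg {f : V → V → ℝ} (hf : ∀ u v, 0 ≤ f u v) (i : ℕ) (u v : V) :
    0 ≤ (transitionMatrix f ^ i) u v := by
  induction i generalizing u v with
  | zero =>
    rw [pow_zero, Matrix.one_apply]
    split_ifs <;> norm_num
  | succ i ih =>
    rw [pow_succ', Matrix.mul_apply]
    exact Finset.sum_nonneg fun w _ =>
      mul_nonneg (div_nonneg (hf _ _) (Finset.sum_nonneg fun _ _ => hf _ _)) (ih w v)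

theorem sum_transitionMatrix_pow_le_one {f : V → V → ℝ} (hf : ∀ u v, 0 ≤ f u v) (i : ℕ) (u : V) :
    ∑ v, (transitionMatrix f ^ i) u v ≤ 1 := by
  induction i generalizing u with
  | zero => simp [Matrix.one_apply]
  | succ i ih =>
    calc ∑ v, (transitionMatrix f ^ (i + 1)) u v
        = ∑ w, transitionMatrix f u w * ∑ v, (transitionMatrix f ^ i) w v := by
          simp only [pow_succ', Matrix.mul_apply, Finset.mul_sum]
          exact Finset.sum_comm
      _ ≤ ∑ w, transitionMatrix f u w * 1 := by
          refine Finset.sum_le_sum fun w _ => mul_le_mul_of_nonneg_left (ih w) ?_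
          simpa using transitionMatrix_pow_nonneg hf 1 u w
      _ ≤ 1 := by simpa using sum_transitionMatrix_le_one f u

/-- Reversibility: on an undirected graph, `d(u) P^i(u, v) = d(v) P^i(v, u)`. -/
theorem transitionMatrix_pow_reversible {f : V → V → ℝ} (hf : ∀ u v, 0 ≤ f u v)
    (hsymm : ∀ u v, f u v = f v u) (i : ℕ) (u v : V) :
    (∑ w, f u w) * (transitionMatrix f ^ i) u v = (∑ w, f v w) * (transitionMatrix f ^ i) v u := by
  have base : ∀ u v, (∑ w, f u w) * transitionMatrix f u v = f u v := by
    intro u v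
    rw [transitionMatrix_apply]
    by_cases h : ∑ w, f u w = 0
    · rw [h, zero_mul]
      exact ((Finset.sum_eq_zero_iff_of_nonneg fun w _ => hf u w).1 h v (Finset.mem_univ v)).symm
    · field_simp
  induction i generalizing u v with
  | zero =>
    simp only [pow_zero, Matrix.one_apply]
    by_cases h : u = v
    · subst h; rfl
    · simp [h, Ne.symm h]
  | succ i ih =>
    have h1 : (∑ w, f u w) * (transitionMatrix f ^ (i + 1)) u v
        = ∑ x, f u x * (transitionMatrix f ^ i) x v := by
      rw [pow_succ', Matrix.mul_apply, Finset.mul_sum]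
      exact Finset.sum_congr rfl fun x _ => by rw [← mul_assoc, base]
    have h2 : (∑ w, f v w) * (transitionMatrix f ^ (i + 1)) v u
        = ∑ x, f x u * (transitionMatrix f ^ i) x v := by
      rw [pow_succ, Matrix.mul_apply, Finset.mul_sum]
      refine Finset.sum_congr rfl fun x _ => ?_
      rw [← mul_assoc, ih, mul_right_comm, base]
    rw [h1, h2]
    exact Finset.sum_congr rfl fun x _ => by rw [hsymm]

/-- If the residual weight `r(u, v)` is at most `d(v) / N`, then a walk that leaves `u` by a residual
step is back at `u` after `i` further steps with weight at most `1 / N`, whatever `i` is. -/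
theorem sum_residual_mul_pow_le {f r : V → V → ℝ} {N : ℝ} (hf : ∀ u v, 0 ≤ f u v)
    (hsymm : ∀ u v, f u v = f v u) (hN : 0 ≤ N) (hr : ∀ u v, r u v ≤ (∑ w, f v w) / N) (i : ℕ)
    {u : V} (hu : 0 < ∑ w, f u w) :
    ∑ v, r u v / (∑ w, f u w) * (transitionMatrix f ^ i) v u ≤ 1 / N := by
  calc ∑ v, r u v / (∑ w, f u w) * (transitionMatrix f ^ i) v u
      ≤ ∑ v, 1 / N * (transitionMatrix f ^ i) u v := by
        refine Finset.sum_le_sum fun v _ => ?_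
        have h := transitionMatrix_pow_reversible hf hsymm i v u
        have h' := mul_le_mul_of_nonneg_right (hr u v) (transitionMatrix_pow_nonneg hf i v u)
        rw [div_mul_eq_mul_div, h] at h'
        rw [div_mul_eq_mul_div, div_le_iff₀ hu]
        calc _ ≤ _ := h'
          _ = _ := by ring
    _ = 1 / N * ∑ v, (transitionMatrix f ^ i) u v := by rw [Finset.mul_sum]
    _ ≤ 1 / N * 1 :=
        mul_le_mul_of_nonneg_left (sum_transitionMatrix_pow_le_one hf i u) (by positivity)
    _ = 1 / N := mul_one _

/-- The law of the next `T` vertices of the walk from `x` with edge weights `g + r`, restricted to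
the event that every vertex `u` is left by at most `k u` residual steps. A step is residual when it
is taken with weight `r` instead of `g`. -/
def budgetedWalk (g r : V → V → ℝ) : (T : ℕ) → V → (V → ℕ) → (Fin T → V) → ℝ
  | 0, _, _, _ => 1
  | T + 1, x, k, w =>
      g x (w 0) / (∑ v, (g x v + r x v)) * budgetedWalk g r T (w 0) k (Fin.tail w) +
      r x (w 0) / (∑ v, (g x v + r x v)) *
        (if k x = 0 then 0
          else budgetedWalk g r T (w 0) (Function.update k x (k x - 1)) (Fin.tail w))

/-- One vertex's share of the bound on the probability that some budget runs out: `T` more steps,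
started at `x`, and a budget of `j` residual steps at `u`. The summand with index `i` stands for the
runs with `j + 1` residual steps from `u` of which the first is at time `i`; the remaining `j` times
are chosen among the `T - 1 - i` later ones, at the price of a factor `1 / N` each. -/
def overflowBound (f : V → V → ℝ) (N : ℝ) (T : ℕ) (x u : V) (j : ℕ) : ℝ :=
  ∑ i ∈ Finset.range T, (transitionMatrix f ^ i) x u * (((T - 1 - i).choose j : ℝ) / N ^ j)

theorem overflowBound_succ (f : V → V → ℝ) (N : ℝ) (T : ℕ) (x u : V) (j : ℕ) :
    overflowBound f N (T + 1) x u j =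
      ∑ v, transitionMatrix f x v * overflowBound f N T v u j +
        (if x = u then (T.choose j : ℝ) / N ^ j else 0) := by
  unfold overflowBound
  rw [Finset.sum_range_succ']
  congr 1
  · simp only [Finset.mul_sum]
    rw [Finset.sum_comm]
    refine Finset.sum_congr rfl fun i _ => ?_
    rw [show T + 1 - 1 - (i + 1) = T - 1 - i by omega, pow_succ', Matrix.mul_apply, Finset.sum_mul]
    exact Finset.sum_congr rfl fun v _ => by ring
  · simp [Matrix.one_apply]

theorem sum_range_choose_reflect (T j : ℕ) :
    ∑ i ∈ Finset.range T, (T - 1 - i).choose j = T.choose (j + 1) := by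
  rw [Finset.sum_range_reflect (fun i => i.choose j) T]
  induction T with
  | zero => rfl
  | succ T ih => rw [Finset.sum_range_succ, ih, Nat.choose_succ_succ', add_comm]

theorem overflowBound_nonneg {f : V → V → ℝ} (hf : ∀ u v, 0 ≤ f u v) {N : ℝ} (hN : 0 ≤ N) (T : ℕ)
    (x u : V) (j : ℕ) : 0 ≤ overflowBound f N T x u j :=
  Finset.sum_nonneg fun i _ => mul_nonneg (transitionMatrix_pow_nonneg hf i x u) (by positivity)

/-- The price of a residual step from `u`, which lowers the budget at `u` from `j + 1` to `j`: the
bound `overflowBound` with the lower budget, averaged over the end of that step. -/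
theorem sum_residual_mul_overflowBound_le {f r : V → V → ℝ} {N : ℝ} (hf : ∀ u v, 0 ≤ f u v)
    (hsymm : ∀ u v, f u v = f v u) (hN : 0 ≤ N) (hr : ∀ u v, r u v ≤ (∑ w, f v w) / N)
    {u : V} (hu : 0 < ∑ w, f u w) (T j : ℕ) :
    ∑ v, r u v / (∑ w, f u w) * overflowBound f N T v u j ≤ (T.choose (j + 1) : ℝ) / N ^ (j + 1) := by
  calc ∑ v, r u v / (∑ w, f u w) * overflowBound f N T v u j
      = ∑ i ∈ Finset.range T, (∑ v, r u v / (∑ w, f u w) * (transitionMatrix f ^ i) v u) *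
          (((T - 1 - i).choose j : ℝ) / N ^ j) := by
        simp only [overflowBound, Finset.mul_sum, Finset.sum_mul]
        rw [Finset.sum_comm]
        exact Finset.sum_congr rfl fun i _ => Finset.sum_congr rfl fun v _ => by ring
    _ ≤ ∑ i ∈ Finset.range T, 1 / N * (((T - 1 - i).choose j : ℝ) / N ^ j) :=
        Finset.sum_le_sum fun i _ => mul_le_mul_of_nonneg_right
          (sum_residual_mul_pow_le hf hsymm hN hr i hu) (by positivity)
    _ = (T.choose (j + 1) : ℝ) / N ^ (j + 1) := by
        rw [← sum_range_choose_reflect, Nat.cast_sum, Finset.sum_div]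
        refine Finset.sum_congr rfl fun i _ => ?_
        rw [pow_succ]
        ring

theorem sum_budgetedWalk_succ (g r : V → V → ℝ) (T : ℕ) (x : V) (k : V → ℕ) :
    ∑ w, budgetedWalk g r (T + 1) x k w =
      ∑ v, (g x v / (∑ w, (g x w + r x w)) * ∑ w, budgetedWalk g r T v k w +
        r x v / (∑ w, (g x w + r x w)) *
          (if k x = 0 then 0 else ∑ w, budgetedWalk g r T v (Function.update k x (k x - 1)) w)) := by
  rw [Fin.sum_univ_pi_succ]
  refine Finset.sum_congr rfl fun v _ => ?_
  simp only [budgetedWalk, Fin.cons_zero, Fin.tail_cons, Finset.sum_add_distrib, ← Finset.mul_sum]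
  split_ifs <;> simp

/-- The probability that some budget runs out, by induction on the number of steps: a residual step
from `x` lowers the budget of `x` only, and the price of this is `sum_residual_mul_overflowBound_le`. -/
theorem one_sub_sum_budgetedWalk_le {g r : V → V → ℝ} {N : ℝ} (hg : ∀ u v, 0 ≤ g u v)
    (hr0 : ∀ u v, 0 ≤ r u v) (hsymm : ∀ u v, g u v + r u v = g v u + r v u) (hN : 0 ≤ N)
    (hr : ∀ u v, r u v ≤ (∑ w, (g v w + r v w)) / N) (T : ℕ) {x : V} (k : V → ℕ)
    (hx : 0 < ∑ w, (g x w + r x w)) :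
    1 - ∑ w, budgetedWalk g r T x k w ≤
      ∑ u, (∑ v, r u v) / (∑ w, (g u w + r u w)) *
        overflowBound (fun u v => g u v + r u v) N T x u (k u) := by
  have hf : ∀ u v, 0 ≤ g u v + r u v := fun u v => add_nonneg (hg u v) (hr0 u v)
  set f : V → V → ℝ := fun u v => g u v + r u v with hfdef
  set d : V → ℝ := fun u => ∑ w, (g u w + r u w) with hddef
  have hd : ∀ u, 0 ≤ d u := fun u => Finset.sum_nonneg fun w _ => hf u w
  set ρ : V → ℝ := fun u => (∑ v, r u v) / d u with hρ
  have hρ0 : ∀ u, 0 ≤ ρ u := fun u =>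
    div_nonneg (Finset.sum_nonneg fun v _ => hr0 u v) (hd u)
  set U : ℕ → V → (V → ℕ) → ℝ := fun T x k => ∑ u, ρ u * overflowBound f N T x u (k u) with hU
  change 1 - ∑ w, budgetedWalk g r T x k w ≤ U T x k
  induction T generalizing x k with
  | zero => simp [budgetedWalk, hU, overflowBound]
  | succ T ih =>
    have hx' : 0 < d x := hx
    have hpos : ∀ v, 0 < f x v → 0 < d v := fun v hv =>
      lt_of_lt_of_le (by rw [hfdef] at hv; simpa only [hsymm x v] using hv)
        (Finset.single_le_sum (f := fun w => g v w + r v w) (fun w _ => hf v w) (Finset.mem_univ x))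
    have hsum : ∑ v, (g x v / d x + r x v / d x) = 1 := by
      simp only [← add_div, ← Finset.sum_div]
      exact div_self hx'.ne'
    -- the change of the bound when the budget of `x` is lowered by one
    have hlower : ∀ v, k x ≠ 0 → U T v (Function.update k x (k x - 1)) ≤
        U T v k + ρ x * overflowBound f N T v x (k x - 1) := by
      intro v _
      simp only [hU]
      rw [← Finset.add_sum_erase _ _ (Finset.mem_univ x),
        ← Finset.add_sum_erase (a := x) _ (fun u => ρ u * overflowBound f N T v u (k u))
          (Finset.mem_univ x)]
      have h1 : ∑ u ∈ Finset.univ.erase x,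
          ρ u * overflowBound f N T v u (Function.update k x (k x - 1) u) =
          ∑ u ∈ Finset.univ.erase x, ρ u * overflowBound f N T v u (k u) :=
        Finset.sum_congr rfl fun u hu => by
          rw [Function.update_of_ne (Finset.ne_of_mem_erase hu)]
      rw [h1, Function.update_self]
      have h2 := mul_nonneg (hρ0 x) (overflowBound_nonneg hf hN T v x (k x))
      linarith
    have hstep : ∀ v, g x v / d x * (1 - ∑ w, budgetedWalk g r T v k w) +
        r x v / d x * (1 - if k x = 0 then 0
          else ∑ w, budgetedWalk g r T v (Function.update k x (k x - 1)) w) ≤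
        f x v / d x * U T v k + r x v / d x * (if k x = 0 then 1
          else ρ x * overflowBound f N T v x (k x - 1)) := by
      intro v
      have hU0 : 0 ≤ U T v k := Finset.sum_nonneg fun u _ =>
        mul_nonneg (hρ0 u) (overflowBound_nonneg hf hN T v u (k u))
      rcases (hf x v).eq_or_lt with h0 | h0
      · have hg0 : g x v = 0 := by linarith [hg x v, hr0 x v]
        have hr00 : r x v = 0 := by linarith [hg x v, hr0 x v]
        simp [hg0, hr00, hfdef]
      · have hv := hpos v h0
        have hgd : 0 ≤ g x v / d x := div_nonneg (hg x v) hx'.le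
        have hrd : 0 ≤ r x v / d x := div_nonneg (hr0 x v) hx'.le
        have e1 := mul_le_mul_of_nonneg_left (ih k hv) hgd
        have e2 : r x v / d x * (1 - if k x = 0 then 0
            else ∑ w, budgetedWalk g r T v (Function.update k x (k x - 1)) w) ≤
            r x v / d x * (U T v k + if k x = 0 then 1
              else ρ x * overflowBound f N T v x (k x - 1)) := by
          refine mul_le_mul_of_nonneg_left ?_ hrd
          split_ifs with hk
          · linarith
          · exact (ih _ hv).trans (hlower v hk)
        have e3 : f x v / d x = g x v / d x + r x v / d x := add_div _ _ _
        rw [e3]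
        linarith
    -- the residual step at time zero accounts for the last term of `overflowBound_succ`
    have hres : ∑ v, r x v / d x * (if k x = 0 then 1
        else ρ x * overflowBound f N T v x (k x - 1)) ≤ ρ x * ((T.choose (k x) : ℝ) / N ^ k x) := by
      by_cases hk : k x = 0
      · simp [hk, hρ, Finset.sum_div]
      · obtain ⟨j, hj⟩ := Nat.exists_eq_succ_of_ne_zero hk
        simp only [hk, if_false]
        rw [hj, Nat.succ_eq_add_one, Nat.add_sub_cancel]
        have := mul_le_mul_of_nonneg_left
          (sum_residual_mul_overflowBound_le hf hsymm hN hr hx T j) (hρ0 x)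
        refine le_trans (le_of_eq ?_) this
        rw [Finset.mul_sum]
        exact Finset.sum_congr rfl fun v _ => by ring
    have hrec : U (T + 1) x k =
        ∑ v, f x v / d x * U T v k + ρ x * ((T.choose (k x) : ℝ) / N ^ k x) := by
      simp only [hU, overflowBound_succ, mul_add, Finset.sum_add_distrib, mul_ite, mul_zero,
        Finset.sum_ite_eq, Finset.mem_univ, if_true, Finset.mul_sum]
      congr 1
      rw [Finset.sum_comm]
      refine Finset.sum_congr rfl fun v _ => Finset.sum_congr rfl fun u _ => ?_
      rw [transitionMatrix_apply]
      ring
    calc 1 - ∑ w, budgetedWalk g r (T + 1) x k w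
        = ∑ v, (g x v / d x * (1 - ∑ w, budgetedWalk g r T v k w) +
            r x v / d x * (1 - if k x = 0 then 0
              else ∑ w, budgetedWalk g r T v (Function.update k x (k x - 1)) w)) := by
          rw [sum_budgetedWalk_succ]
          nth_rewrite 1 [← hsum]
          rw [← Finset.sum_sub_distrib]
          refine Finset.sum_congr rfl fun v _ => ?_
          simp only [hddef]
          ring
      _ ≤ ∑ v, (f x v / d x * U T v k + r x v / d x * (if k x = 0 then 1
          else ρ x * overflowBound f N T v x (k x - 1))) := Finset.sum_le_sum fun v _ => hstep v
      _ ≤ U (T + 1) x k := by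
          rw [hrec, Finset.sum_add_distrib]
          exact add_le_add le_rfl hres

/-- With the same budget `C` at all vertices, some budget runs out within `T` steps with probability
at most `T.choose (C + 1) / N ^ C`; the number of vertices does not enter, since the chain is at one
vertex at a time. -/
theorem one_sub_sum_budgetedWalk_const_le {g r : V → V → ℝ} {N : ℝ} (hg : ∀ u v, 0 ≤ g u v)
    (hr0 : ∀ u v, 0 ≤ r u v) (hsymm : ∀ u v, g u v + r u v = g v u + r v u) (hN : 0 ≤ N)
    (hr : ∀ u v, r u v ≤ (∑ w, (g v w + r v w)) / N) (T C : ℕ) {x : V}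
    (hx : 0 < ∑ w, (g x w + r x w)) :
    1 - ∑ w, budgetedWalk g r T x (fun _ => C) w ≤ (T.choose (C + 1) : ℝ) / N ^ C := by
  have hf : ∀ u v, 0 ≤ g u v + r u v := fun u v => add_nonneg (hg u v) (hr0 u v)
  refine (one_sub_sum_budgetedWalk_le hg hr0 hsymm hN hr T _ hx).trans ?_
  calc ∑ u, (∑ v, r u v) / (∑ w, (g u w + r u w)) *
        overflowBound (fun u v => g u v + r u v) N T x u C
      ≤ ∑ u, overflowBound (fun u v => g u v + r u v) N T x u C := by
        refine Finset.sum_le_sum fun u _ =>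
          mul_le_of_le_one_left (overflowBound_nonneg hf hN T x u C) ?_
        exact div_le_one_of_le₀ (Finset.sum_le_sum fun v _ => by linarith [hg u v])
          (Finset.sum_nonneg fun w _ => hf u w)
    _ = ∑ i ∈ Finset.range T, (∑ u, (transitionMatrix (fun u v => g u v + r u v) ^ i) x u) *
          (((T - 1 - i).choose C : ℝ) / N ^ C) := by
        simp only [overflowBound, Finset.sum_mul]
        exact Finset.sum_comm
    _ ≤ ∑ i ∈ Finset.range T, 1 * (((T - 1 - i).choose C : ℝ) / N ^ C) :=
        Finset.sum_le_sum fun i _ => mul_le_mul_of_nonneg_right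
          (sum_transitionMatrix_pow_le_one hf i x) (by positivity)
    _ = (T.choose (C + 1) : ℝ) / N ^ C := by
        simp only [one_mul]
        rw [← sum_range_choose_reflect, Nat.cast_sum, Finset.sum_div]

end BudgetedWalk

/-! ### Laws on finite types: weights, products, reservoir sampling -/

namespace PMF

variable {α β : Type*}

theorem ext_toReal {p q : PMF α} (h : ∀ a, (p a).toReal = (q a).toReal) : p = q :=
  PMF.ext fun a => (ENNReal.toReal_eq_toReal_iff' (p.apply_ne_top a) (q.apply_ne_top a)).1 (h a)

variable [Fintype α]

theorem sum_toReal (p : PMF α) : ∑ a, (p a).toReal = 1 := by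
  rw [← ENNReal.toReal_sum fun a _ => p.apply_ne_top a, ← tsum_fintype (L := .unconditional _),
    p.tsum_coe, ENNReal.toReal_one]

theorem bind_apply_toReal (p : PMF α) (f : α → PMF β) (b : β) :
    (p.bind f b).toReal = ∑ a, (p a).toReal * (f a b).toReal := by
  rw [bind_apply, tsum_fintype,
    ENNReal.toReal_sum fun a _ => ENNReal.mul_ne_top (p.apply_ne_top a) ((f a).apply_ne_top b)]
  exact Finset.sum_congr rfl fun a _ => ENNReal.toReal_mul

theorem map_apply_toReal [DecidableEq β] (p : PMF α) (f : α → β) (b : β) :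
    (p.map f b).toReal = ∑ a, if b = f a then (p a).toReal else 0 := by
  rw [← bind_pure_comp, bind_apply_toReal]
  refine Finset.sum_congr rfl fun a _ => ?_
  simp only [Function.comp_apply, pure_apply]
  split_ifs <;> simp

/-- The law on a finite type with mass proportional to `w`, and concentrated at `a₀` if all weights
are zero. -/
def ofWeights (w : α → ℕ) (a₀ : α) : PMF α :=
  if h : ∑ a, w a = 0 then pure a₀
  else ofFintype (fun a => (w a : ENNReal) / (∑ b, w b : ℕ)) (by
    simp only [div_eq_mul_inv]
    rw [← Finset.sum_mul, ← Nat.cast_sum]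
    exact ENNReal.mul_inv_cancel (by exact_mod_cast h) (ENNReal.natCast_ne_top _))

theorem ofWeights_of_sum_eq_zero {w : α → ℕ} {a₀ : α} (h : ∑ a, w a = 0) :
    ofWeights w a₀ = pure a₀ := dif_pos h

theorem ofWeights_apply_toReal {w : α → ℕ} {a₀ : α} (h : ∑ a, w a ≠ 0) (a : α) :
    (ofWeights w a₀ a).toReal = (w a : ℝ) / (∑ b, w b : ℕ) := by
  rw [ofWeights, dif_neg h, ofFintype_apply, ENNReal.toReal_div, ENNReal.toReal_natCast,
    ENNReal.toReal_natCast]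

section Pi

variable {ι : Type*} [Fintype ι] [DecidableEq ι]

/-- The joint law of independent random variables with laws `μ i`. -/
def pi (μ : ι → PMF α) : PMF (ι → α) :=
  ofFintype (fun a => ∏ i, μ i (a i)) (by
    have h := Finset.prod_univ_sum (fun _ : ι => (Finset.univ : Finset α)) fun i a => μ i a
    rw [Fintype.piFinset_univ] at h
    rw [← h]
    refine Finset.prod_eq_one fun i _ => ?_
    rw [← tsum_fintype (L := .unconditional _), (μ i).tsum_coe])

theorem pi_apply (μ : ι → PMF α) (a : ι → α) : pi μ a = ∏ i, μ i (a i) := rfl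

theorem pi_bind_pi (μ : ι → PMF α) (κ : ι → α → PMF α) :
    ((pi μ).bind fun a => pi fun i => κ i (a i)) = pi fun i => (μ i).bind (κ i) := by
  ext b
  simp only [bind_apply, pi_apply, tsum_fintype, ← Finset.prod_mul_distrib]
  have h := Finset.prod_univ_sum (fun _ : ι => (Finset.univ : Finset α))
    fun i a => μ i a * κ i a (b i)
  rw [Fintype.piFinset_univ] at h
  exact h.symm

theorem pi_pure (a : ι → α) : (pi fun i => pure (a i)) = pure a := by
  classical
  ext b
  rw [pi_apply, pure_apply]
  by_cases h : b = a
  · subst h; simp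
  · obtain ⟨i, hi⟩ := Function.ne_iff.1 h
    rw [if_neg h]
    exact Finset.prod_eq_zero (Finset.mem_univ i) (pure_apply_of_ne _ _ hi)

theorem pi_update_pure (a : ι → α) (i : ι) (ν : PMF α) :
    pi (Function.update (fun l => pure (a l)) i ν) = ν.map fun b => Function.update a i b := by
  classical
  have h : ∀ c, pure (Function.update a i c) = pi fun l => pure (Function.update a i c l) :=
    fun c => (pi_pure _).symm
  ext b
  rw [← bind_pure_comp, bind_apply, tsum_fintype, pi_apply,
    ← Finset.mul_prod_erase _ _ (Finset.mem_univ i)]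
  simp only [Function.comp_apply, h, pi_apply]
  simp only [← Finset.mul_prod_erase _ _ (Finset.mem_univ i), Function.update_self, pure_apply]
  have h1 : ∀ c, ∏ l ∈ Finset.univ.erase i, (if b l = Function.update a i c l then (1 : ENNReal) else 0)
      = ∏ l ∈ Finset.univ.erase i, (if b l = a l then (1 : ENNReal) else 0) := fun c =>
    Finset.prod_congr rfl fun l hl => by rw [Function.update_of_ne (Finset.ne_of_mem_erase hl)]
  have h2 : ∏ l ∈ Finset.univ.erase i, Function.update (fun l => pure (a l)) i ν l (b l)
      = ∏ l ∈ Finset.univ.erase i, (if b l = a l then (1 : ENNReal) else 0) :=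
    Finset.prod_congr rfl fun l hl => by
      rw [Function.update_of_ne (Finset.ne_of_mem_erase hl), pure_apply]
  simp only [h1, h2, ← mul_assoc]
  rw [← Finset.sum_mul]
  simp

/-- Redrawing the `i`-th of several independent variables changes its law only. -/
theorem pi_update (μ : ι → PMF α) (i : ι) (ν : PMF α) :
    pi (Function.update μ i ν) =
      (pi μ).bind fun a => ν.map fun b => Function.update a i b := by
  simp only [← pi_update_pure]
  have h : ∀ a : ι → α, Function.update (fun l => pure (a l)) i ν =
      fun l => Function.update (fun l x => pure x) i (fun _ => ν) l (a l) := by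
    intro a
    funext l
    by_cases hl : l = i
    · subst hl; simp
    · simp [hl]
  simp only [h]
  rw [pi_bind_pi]
  congr 1
  funext l
  by_cases hl : l = i
  · subst hl; simp
  · simp [hl]

end Pi

/-- The law of a sample `some v` with probability proportional to `r v`, where `none` stands for the
missing sample from an empty population. -/
def sampleLaw (r : α → ℕ) : PMF (Option α) :=
  ofWeights (fun o => o.elim 0 r) none

/-- Reservoir sampling: how a sample from a population of size `R` is replaced when `Δ v` copies of
each `v` join the population. -/
def reservoirStep (R : ℕ) (Δ : α → ℕ) (old : Option α) : PMF (Option α) :=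
  (ofWeights (fun o : Option α => o.elim R Δ) none).map fun o => o.or old

theorem sampleLaw_of_sum_eq_zero {r : α → ℕ} (h : ∑ v, r v = 0) : sampleLaw r = pure none :=
  ofWeights_of_sum_eq_zero (by simpa [Fintype.sum_option] using h)

theorem sampleLaw_apply_toReal {r : α → ℕ} (h : ∑ v, r v ≠ 0) (o : Option α) :
    (sampleLaw r o).toReal = (o.elim 0 r : ℕ) / (∑ v, r v : ℕ) := by
  rw [sampleLaw, ofWeights_apply_toReal (by simpa [Fintype.sum_option] using h)]
  simp [Fintype.sum_option]

theorem sampleLaw_bind_reservoirStep [DecidableEq α] (r Δ : α → ℕ) :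
    (sampleLaw r).bind (reservoirStep (∑ v, r v) Δ) = sampleLaw fun v => r v + Δ v := by
  by_cases hr : ∑ v, r v = 0
  · have hr' : r = 0 := by
      funext v
      exact Finset.sum_eq_zero_iff.1 hr v (Finset.mem_univ v)
    subst hr'
    rw [sampleLaw_of_sum_eq_zero hr, pure_bind]
    simp only [reservoirStep, Option.or_none, Pi.zero_apply, zero_add, Finset.sum_const_zero]
    exact map_id _
  · have hw : ∑ o : Option α, (o.elim (∑ v, r v) Δ : ℕ) = ∑ v, (r v + Δ v) := by
      simp [Fintype.sum_option, Finset.sum_add_distrib]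
    have hr' : ∑ v, (r v + Δ v) ≠ 0 := by
      rw [Finset.sum_add_distrib]
      omega
    refine ext_toReal fun b => ?_
    rw [bind_apply_toReal, sampleLaw_apply_toReal hr']
    simp only [sampleLaw_apply_toReal hr, reservoirStep, map_apply_toReal]
    simp only [ofWeights_apply_toReal (hw ▸ hr'), hw, Fintype.sum_option]
    have hR : ((∑ v, r v : ℕ) : ℝ) ≠ 0 := by exact_mod_cast hr
    have hR' : ((∑ v, (r v + Δ v) : ℕ) : ℝ) ≠ 0 := by exact_mod_cast hr'
    generalize ((∑ v, (r v + Δ v) : ℕ) : ℝ) = R' at *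
    cases b with
    | none => simp
    | some x =>
      simp only [Option.elim, Option.some_or, Option.none_or, Option.some.injEq,
        Finset.sum_ite_eq, Finset.mem_univ, if_true, Nat.cast_zero, zero_div, zero_mul, zero_add,
        mul_add, Finset.sum_add_distrib, ← Finset.sum_mul, ← Finset.sum_div, mul_ite, mul_zero]
      rw [← Nat.cast_sum, div_self hR]
      push_cast at *
      field_simp

end PMF

/-! ### Frequent neighbours -/

section Summary

variable {n : ℕ}

/-- The indicator `1[e = {u, v}]`, that is, what the edge `e` adds to the multiplicities. -/
def edgeInc (e : Sym2 (Fin n)) (u v : Fin n) : ℕ := if e = s(u, v) then 1 else 0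

theorem edgeInc_comm (e : Sym2 (Fin n)) (u v : Fin n) : edgeInc e u v = edgeInc e v u := by
  rw [edgeInc, edgeInc, Sym2.eq_swap]

theorem edgeInc_le_one (e : Sym2 (Fin n)) (u v : Fin n) : edgeInc e u v ≤ 1 := by
  rw [edgeInc]
  split_ifs <;> simp

theorem sum_edgeInc_le_one (e : Sym2 (Fin n)) (u : Fin n) : ∑ v, edgeInc e u v ≤ 1 := by
  simp only [edgeInc]
  rw [← Finset.card_filter, Finset.card_le_one]
  intro a ha b hb
  rw [Finset.mem_filter] at ha hb
  exact Sym2.congr_right.1 (ha.2.symm.trans hb.2)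

theorem edgeMult_append (es : List (Sym2 (Fin n))) (e : Sym2 (Fin n)) (u v : Fin n) :
    edgeMult (es ++ [e]) u v = edgeMult es u v + edgeInc e u v := by
  rw [edgeMult, edgeMult, List.count_append, List.count_singleton, edgeInc]
  simp only [beq_iff_eq]

theorem vertexDegree_append (es : List (Sym2 (Fin n))) (e : Sym2 (Fin n)) (u : Fin n) :
    vertexDegree (es ++ [e]) u = vertexDegree es u + ∑ v, edgeInc e u v := by
  simp only [vertexDegree, edgeMult_append, Finset.sum_add_distrib]

theorem edgeMult_comm (es : List (Sym2 (Fin n))) (u v : Fin n) :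
    edgeMult es u v = edgeMult es v u := by
  rw [edgeMult, edgeMult, Sym2.eq_swap]

theorem vertexDegree_le_length (es : List (Sym2 (Fin n))) (u : Fin n) :
    vertexDegree es u ≤ es.length := by
  induction es using List.reverseRecOn with
  | nil => simp [vertexDegree, edgeMult]
  | append_singleton es e ih =>
    rw [vertexDegree_append, List.length_append, List.length_singleton]
    exact add_le_add ih (sum_edgeInc_le_one e u)

/-- What is remembered of the stream besides the samples: for every vertex `u` its degree, and a
table of counters `table u v` for a few neighbours `v` of `u`. -/
structure Summary (n : ℕ) where
  /-- the counter of the neighbour `v` in the table of `u` -/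
  table : Fin n → Fin n → ℕ
  /-- the degree of a vertex -/
  deg : Fin n → ℕ

namespace Summary

/-- The number of copies of the edge `{u, v}` that are counted in one of the tables of its ends. -/
def stored (D : Summary n) (u v : Fin n) : ℕ := max (D.table u v) (D.table v u)

/-- The number of copies of edges at `u` that are not counted. -/
def residualDeg (D : Summary n) (u : Fin n) : ℕ := D.deg u - ∑ v, D.stored u v

/-- The table of `u` right after the edge `e` was counted, before it is cut back to its capacity. -/
def bumped (D : Summary n) (e : Sym2 (Fin n)) (u v : Fin n) : ℕ := D.table u v + edgeInc e u v

/-- Reading an edge, by the rule of Misra and Gries: the edge is counted, and if a table has more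
than `C` positive counters then, all of them are lowered by one. -/
def insert (C : ℕ) (D : Summary n) (e : Sym2 (Fin n)) : Summary n where
  table u v := if C < (Finset.univ.filter fun w => D.bumped e u w ≠ 0).card
    then D.bumped e u v - 1 else D.bumped e u v
  deg u := D.deg u + ∑ v, edgeInc e u v

/-- The number of copies of the edge `{u, v}` that cease to be counted, or are not counted in the
first place, when the edge `e` is read. -/
def released (C : ℕ) (D : Summary n) (e : Sym2 (Fin n)) (u v : Fin n) : ℕ :=
  D.stored u v + edgeInc e u v - (D.insert C e).stored u v

/-- The summary of a stream. -/
def ofStream (C : ℕ) (es : List (Sym2 (Fin n))) : Summary n :=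
  es.foldl (insert C) ⟨fun _ _ => 0, fun _ => 0⟩

theorem ofStream_append (C : ℕ) (es : List (Sym2 (Fin n))) (e : Sym2 (Fin n)) :
    ofStream C (es ++ [e]) = (ofStream C es).insert C e := by
  simp [ofStream]

theorem deg_ofStream (C : ℕ) (es : List (Sym2 (Fin n))) (u : Fin n) :
    (ofStream C es).deg u = vertexDegree es u := by
  induction es using List.reverseRecOn with
  | nil => simp [ofStream, vertexDegree, edgeMult]
  | append_singleton es e ih => rw [ofStream_append, vertexDegree_append, ← ih]; rfl

theorem table_insert_le (C : ℕ) (D : Summary n) (e : Sym2 (Fin n)) (u v : Fin n) :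
    (D.insert C e).table u v ≤ D.table u v + edgeInc e u v := by
  simp only [insert]
  split_ifs <;> simp only [bumped] <;> omega

theorem stored_insert_le (C : ℕ) (D : Summary n) (e : Sym2 (Fin n)) (u v : Fin n) :
    (D.insert C e).stored u v ≤ D.stored u v + edgeInc e u v := by
  have h1 := table_insert_le C D e u v
  have h2 := table_insert_le C D e v u
  rw [edgeInc_comm e v u] at h2
  simp only [stored]
  omega

theorem table_ofStream_le (C : ℕ) (es : List (Sym2 (Fin n))) (u v : Fin n) :
    (ofStream C es).table u v ≤ edgeMult es u v := by
  induction es using List.reverseRecOn with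
  | nil => simp [ofStream]
  | append_singleton es e ih =>
    rw [ofStream_append, edgeMult_append]
    exact (table_insert_le C _ e u v).trans (Nat.add_le_add_right ih _)

theorem stored_ofStream_le (C : ℕ) (es : List (Sym2 (Fin n))) (u v : Fin n) :
    (ofStream C es).stored u v ≤ edgeMult es u v :=
  max_le (table_ofStream_le C es u v) (edgeMult_comm es v u ▸ table_ofStream_le C es v u)

/-- A table never has more than `C` positive counters: if it is cut back, then a counter that the
new edge made positive drops to zero again. -/
theorem card_table_ofStream_le (C : ℕ) (es : List (Sym2 (Fin n))) (u : Fin n) :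
    (Finset.univ.filter fun v => (ofStream C es).table u v ≠ 0).card ≤ C := by
  induction es using List.reverseRecOn with
  | nil => simp [ofStream]
  | append_singleton es e ih =>
    rw [ofStream_append]
    simp only [insert]
    split_ifs with h
    · refine le_trans (Finset.card_le_card fun v hv => ?_) ih
      rw [Finset.mem_filter] at hv ⊢
      refine ⟨Finset.mem_univ v, ?_⟩
      have hinc := edgeInc_le_one e u v
      have hpos := hv.2
      simp only [bumped] at hpos
      omega
    · exact not_lt.1 h

/-- Here `m` is the number of times that the table of `u` was cut back; each time at least `C + 1` copies
of edges at `u` were uncounted. -/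
theorem exists_rounds (C : ℕ) (es : List (Sym2 (Fin n))) (u : Fin n) :
    ∃ m, (∀ v, edgeMult es u v ≤ (ofStream C es).table u v + m) ∧
      (C + 1) * m + ∑ v, (ofStream C es).table u v ≤ vertexDegree es u := by
  induction es using List.reverseRecOn with
  | nil => exact ⟨0, by simp [edgeMult], by simp [ofStream]⟩
  | append_singleton es e ih =>
    obtain ⟨m, hm, hsum⟩ := ih
    rw [ofStream_append, vertexDegree_append]
    simp only [edgeMult_append, insert]
    set D := ofStream C es
    have hb : ∑ v, D.bumped e u v = ∑ v, D.table u v + ∑ v, edgeInc e u v :=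
      Finset.sum_add_distrib
    split_ifs with h
    · refine ⟨m + 1, fun v => ?_, ?_⟩
      · have := hm v
        simp only [bumped]
        omega
      · have hs : ∑ v, D.bumped e u v = ∑ v, (D.bumped e u v - 1) +
            (Finset.univ.filter fun w => D.bumped e u w ≠ 0).card := by
          rw [Finset.card_filter, ← Finset.sum_add_distrib]
          refine Finset.sum_congr rfl fun v _ => ?_
          split_ifs <;> omega
        rw [mul_add, mul_one]
        omega
    · refine ⟨m, fun v => ?_, ?_⟩
      · have := hm v
        simp only [bumped]
        omega
      · omega

/-- The number of uncounted copies of an edge. -/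
def residual (C : ℕ) (es : List (Sym2 (Fin n))) (u v : Fin n) : ℕ :=
  edgeMult es u v - (ofStream C es).stored u v

theorem stored_add_residual (C : ℕ) (es : List (Sym2 (Fin n))) (u v : Fin n) :
    (ofStream C es).stored u v + residual C es u v = edgeMult es u v :=
  Nat.add_sub_cancel' (stored_ofStream_le C es u v)

theorem residual_append (C : ℕ) (es : List (Sym2 (Fin n))) (e : Sym2 (Fin n)) (u v : Fin n) :
    residual C (es ++ [e]) u v = residual C es u v + (ofStream C es).released C e u v := by
  have h1 := stored_ofStream_le C es u v
  have h2 := stored_insert_le C (ofStream C es) e u v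
  rw [residual, residual, released, edgeMult_append, ofStream_append]
  omega

theorem sum_residual (C : ℕ) (es : List (Sym2 (Fin n))) (u : Fin n) :
    ∑ v, residual C es u v = (ofStream C es).residualDeg u := by
  rw [residualDeg, deg_ofStream, vertexDegree]
  simp only [← stored_add_residual C es, Finset.sum_add_distrib]
  omega

/-- An edge has few uncounted copies in comparison with the degrees of both its ends. -/
theorem mul_residual_le (C : ℕ) (es : List (Sym2 (Fin n))) (u v : Fin n) :
    (C + 1) * residual C es u v ≤ vertexDegree es v := by
  obtain ⟨m, hm, hsum⟩ := exists_rounds C es v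
  have h1 : residual C es u v ≤ m := by
    have := hm u
    rw [edgeMult_comm] at this
    have h2 : (ofStream C es).table v u ≤ (ofStream C es).stored u v := le_max_right _ _
    rw [residual]
    omega
  exact (Nat.mul_le_mul_left _ h1).trans (le_trans (Nat.le_add_right _ _) hsum)

end Summary

end Summary

/-! ### Memory layout -/

section Memory

variable {n C : ℕ}

/-- The samples in memory, `C` for every vertex; `none` marks a missing or used sample. -/
abbrev Samples (n C : ℕ) : Type := Fin n × Fin C → Option (Fin n)

/-- The content of the memory; `pos` is the current vertex of the walk. -/
structure WalkState (n C : ℕ) where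
  /-- degrees and tables of counters -/
  summary : Summary n
  /-- the current vertex of the walk -/
  pos : Fin n
  /-- the samples of uncounted edges -/
  samples : Samples n C

/-- The memory words: for every vertex `C` names of neighbours, `C` counters, `C` samples and the
degree, and one word for the current vertex. -/
abbrev MemIndex (n C : ℕ) : Type :=
  (Fin n × Fin C) ⊕ (Fin n × Fin C) ⊕ (Fin n × Fin C) ⊕ Fin n ⊕ Unit

/-- The number of memory words. -/
abbrev memSize (n C : ℕ) : ℕ := Fintype.card (MemIndex n C)

theorem memSize_eq (n C : ℕ) : memSize n C = 3 * (n * C) + n + 1 := by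
  simp only [memSize, Fintype.card_sum, Fintype.card_prod, Fintype.card_fin, Fintype.card_unit]
  ring

/-- The state that a memory content stands for. Empty places of a table have counter `0`, and a
sample is missing when its word is not the number of a vertex. -/
def decode [NeZero n] (M : Fin (memSize n C) → ℕ) : WalkState n C where
  summary :=
    { table := fun u v => ∑ j, if M (Fintype.equivFin _ (.inl (u, j))) = (v : ℕ)
        then M (Fintype.equivFin _ (.inr (.inl (u, j)))) else 0
      deg := fun u => M (Fintype.equivFin _ (.inr (.inr (.inr (.inl u))))) }
  pos := Fin.ofNat n (M (Fintype.equivFin _ (.inr (.inr (.inr (.inr ()))))))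
  samples := fun p => if h : M (Fintype.equivFin _ (.inr (.inr (.inl p)))) < n
    then some ⟨_, h⟩ else none

theorem exists_table_layout (h : Fin n → ℕ) (hcard : (Finset.univ.filter fun v => h v ≠ 0).card ≤ C) :
    ∃ s : Fin C → Option (Fin n), ∀ v, ∑ j, (if s j = some v then h v else 0) = h v := by
  classical
  have hc : Fintype.card {v // h v ≠ 0} ≤ Fintype.card (Fin C) := by
    rwa [Fintype.card_subtype, Fintype.card_fin]
  obtain ⟨φ⟩ := Function.Embedding.nonempty_of_card_le hc
  refine ⟨fun j => (Function.partialInv φ j).map Subtype.val, fun v => ?_⟩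
  by_cases hv : h v = 0
  · simp [hv]
  · rw [Finset.sum_eq_single (φ ⟨v, hv⟩)]
    · beta_reduce
      rw [Function.partialInv_left φ.injective]
      simp
    · intro j _ hj
      rw [if_neg]
      intro hs
      obtain ⟨a, ha, hav⟩ := Option.map_eq_some_iff.1 hs
      have hj' := (φ.injective.isPartialInv _ _).1 ha
      subst hav
      exact hj hj'.symm
    · simp

theorem exists_decode_eq [NeZero n] (st : WalkState n C)
    (hst : ∀ u, (Finset.univ.filter fun v => st.summary.table u v ≠ 0).card ≤ C) :
    ∃ M : Fin (memSize n C) → ℕ, decode M = st ∧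
      ∀ X, n ≤ X → (∀ u v, st.summary.table u v ≤ X) → (∀ u, st.summary.deg u ≤ X) →
        ∀ i, M i ≤ X := by
  choose s hs using fun u => exists_table_layout (st.summary.table u) (hst u)
  let word : MemIndex n C → ℕ := fun
    | .inl (u, j) => (s u j).elim 0 Fin.val
    | .inr (.inl (u, j)) => (s u j).elim 0 (st.summary.table u)
    | .inr (.inr (.inl p)) => (st.samples p).elim n Fin.val
    | .inr (.inr (.inr (.inl u))) => st.summary.deg u
    | .inr (.inr (.inr (.inr ()))) => st.pos
  refine ⟨fun i => word ((Fintype.equivFin _).symm i), ?_, ?_⟩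
  · obtain ⟨⟨table, deg⟩, pos, samples⟩ := st
    simp only [decode, Equiv.symm_apply_apply, WalkState.mk.injEq, Summary.mk.injEq, word]
    refine ⟨⟨?_, trivial⟩, ?_, ?_⟩
    · funext u v
      refine Eq.trans ?_ (hs u v)
      refine Finset.sum_congr rfl fun j _ => ?_
      cases hsj : s u j with
      | none =>
        simp only [Option.elim, reduceCtorEq, if_false]
        exact ite_self 0
      | some a =>
        simp only [Option.elim, Option.some.injEq, Fin.val_inj]
        by_cases hav : a = v
        · simp [hav]
        · simp [hav]
    · simp
    · funext p
      have hword : ∀ o : Option (Fin n), (if h : o.elim n Fin.val < n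
          then some (⟨o.elim n Fin.val, h⟩ : Fin n) else none) = o := by
        rintro (_ | a) <;> simp
      exact hword (samples p)
  · intro X hn ht hd i
    have hword : ∀ l, word l ≤ X := by
      rintro (⟨u, j⟩ | ⟨u, j⟩ | p | u | ⟨⟩)
      · cases hsj : s u j with
        | none => simp [word, hsj]
        | some a => simpa [word, hsj] using a.2.le.trans hn
      · cases hsj : s u j with
        | none => simp [word, hsj]
        | some a => simpa [word, hsj] using ht u a
      · cases hp : st.samples p with
        | none => simpa [word, hp] using hn
        | some a => simpa [word, hp] using a.2.le.trans hn
      · exact hd u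
      · exact st.pos.2.le.trans hn
    exact hword _

open Classical in
/-- A memory content that stands for the given state. -/
def encode [NeZero n] (st : WalkState n C) : Fin (memSize n C) → ℕ :=
  if h : ∀ u, (Finset.univ.filter fun v => st.summary.table u v ≠ 0).card ≤ C
  then (exists_decode_eq st h).choose else 0

theorem decode_encode [NeZero n] (es : List (Sym2 (Fin n))) (x : Fin n) (a : Samples n C) :
    decode (encode ⟨Summary.ofStream C es, x, a⟩) = ⟨Summary.ofStream C es, x, a⟩ := by
  have h := Summary.card_table_ofStream_le C es
  rw [encode, dif_pos h]
  exact (exists_decode_eq ⟨Summary.ofStream C es, x, a⟩ h).choose_spec.1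

theorem encode_le [NeZero n] (es : List (Sym2 (Fin n))) (x : Fin n) (a : Samples n C)
    (i : Fin (memSize n C)) :
    encode ⟨Summary.ofStream C es, x, a⟩ i ≤ max 2 (max n es.length) := by
  have h := Summary.card_table_ofStream_le C es
  rw [encode, dif_pos h]
  refine (exists_decode_eq ⟨Summary.ofStream C es, x, a⟩ h).choose_spec.2 _ (by simp)
    (fun u v => ?_) (fun u => ?_) i
  · exact (Summary.table_ofStream_le C es u v).trans (List.count_le_length.trans (by simp))
  · rw [Summary.deg_ofStream]
    exact (vertexDegree_le_length es u).trans (by simp)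

end Memory

/-! ### The streaming algorithm -/

section Algorithm

variable {n : ℕ}

/-- Take an unused sample of `x`, the one with the largest index, and mark it as used. If there is
none, the output `x` is arbitrary. -/
def popSample {C : ℕ} (x : Fin n) (a : Samples n C) : Fin n × Samples n C :=
  if h : (Finset.univ.filter fun j => a (x, j) ≠ none).Nonempty then
    ((a (x, Finset.max' _ h)).getD x, Function.update a (x, Finset.max' _ h) none)
  else (x, a)

/-- The choice of a step from `x`: along a counted edge, to `some v`, or along an uncounted edge. -/
def stepChoice (D : Summary n) (x : Fin n) : PMF (Option (Fin n)) :=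
  PMF.ofWeights (fun o => o.elim (D.residualDeg x) (D.stored x)) none

/-- One step of the walk: the next vertex, and the samples that are left. -/
def walkStep {C : ℕ} (D : Summary n) (x : Fin n) (a : Samples n C) : PMF (Fin n × Samples n C) :=
  (stepChoice D x).map fun o => o.elim (popSample x a) fun v => (v, a)

/-- The law of the next `k` vertices that are output. -/
def walkLaw {C : ℕ} (D : Summary n) : (k : ℕ) → Fin n → Samples n C → PMF (Fin k → Fin n)
  | 0, _, _ => PMF.pure Fin.elim0
  | k + 1, x, a => (walkStep D x a).bind fun y => (walkLaw D k y.1 y.2).map (Fin.cons y.1)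

/-- The streaming algorithm with `C` counters and `C` samples for every vertex. -/
def walkAlg (n C : ℕ) [NeZero n] : WalkStreamAlg n (memSize n C) where
  init := encode ⟨Summary.ofStream C [], 0, fun _ => none⟩
  update M e :=
    (PMF.pi fun p : Fin n × Fin C => PMF.reservoirStep ((decode M).summary.residualDeg p.1)
      ((decode M).summary.released C e p.1) ((decode M).samples p)).map
      fun a => encode ⟨(decode M).summary.insert C e, (decode M).pos, a⟩
  query M s := PMF.pure (encode ⟨(decode M).summary, s, (decode M).samples⟩)
  step M := (walkStep (decode M).summary (decode M).pos (decode M).samples).map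
    fun y => (y.1, encode ⟨(decode M).summary, y.1, y.2⟩)

theorem WalkStreamAlg.readFrom_append {S : ℕ} (A : WalkStreamAlg n S) (es : List (Sym2 (Fin n)))
    (e : Sym2 (Fin n)) (M : Fin S → ℕ) :
    A.readFrom (es ++ [e]) M = (A.readFrom es M).bind fun M' => A.update M' e := by
  induction es generalizing M with
  | nil => simp [readFrom]
  | cons e' es ih =>
    simp only [List.cons_append, readFrom, PMF.bind_bind]
    exact congrArg _ (funext ih)

variable {C : ℕ} [NeZero n]

/-- After the stream, the samples are independent, and those of a vertex `u` are uniform among the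
uncounted edges at `u`. -/
theorem readFrom_walkAlg (es : List (Sym2 (Fin n))) :
    (walkAlg n C).readFrom es (walkAlg n C).init =
      (PMF.pi fun p : Fin n × Fin C => PMF.sampleLaw (Summary.residual C es p.1)).map
        fun a => encode ⟨Summary.ofStream C es, 0, a⟩ := by
  induction es using List.reverseRecOn with
  | nil =>
    have h : ∀ u, PMF.sampleLaw (Summary.residual C ([] : List (Sym2 (Fin n))) u) = PMF.pure none :=
      fun u => PMF.sampleLaw_of_sum_eq_zero (by simp [Summary.residual, edgeMult])
    simp only [h, PMF.pi_pure, PMF.pure_map]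
    rfl
  | append_singleton es e ih =>
    rw [WalkStreamAlg.readFrom_append, ih, PMF.bind_map]
    simp only [Function.comp_def, walkAlg, decode_encode]
    rw [← PMF.map_bind, PMF.pi_bind_pi, ← Summary.ofStream_append]
    congr 2
    funext p
    rw [← Summary.sum_residual, PMF.sampleLaw_bind_reservoirStep]
    congr 1
    funext v
    rw [Summary.residual_append]

theorem step_walkAlg (es : List (Sym2 (Fin n))) (x : Fin n) (a : Samples n C) :
    (walkAlg n C).step (encode ⟨Summary.ofStream C es, x, a⟩) =
      (walkStep (Summary.ofStream C es) x a).map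
        fun y => (y.1, encode ⟨Summary.ofStream C es, y.1, y.2⟩) := by
  simp only [walkAlg, decode_encode]

theorem emit_walkAlg_map_fst (es : List (Sym2 (Fin n))) (k : ℕ) (x : Fin n) (a : Samples n C) :
    ((walkAlg n C).emit k (encode ⟨Summary.ofStream C es, x, a⟩)).map Prod.fst =
      walkLaw (Summary.ofStream C es) k x a := by
  induction k generalizing x a with
  | zero => simp [WalkStreamAlg.emit, walkLaw, PMF.pure_map]
  | succ k ih =>
    simp only [WalkStreamAlg.emit, walkLaw, step_walkAlg, PMF.bind_map, PMF.map_bind]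
    congr 1
    funext y
    simp only [Function.comp_apply, PMF.map_comp, ← ih]
    rfl

theorem exists_encode_of_mem_support_emit (es : List (Sym2 (Fin n))) (k : ℕ) (x : Fin n)
    (a : Samples n C) :
    ∀ y ∈ ((walkAlg n C).emit k (encode ⟨Summary.ofStream C es, x, a⟩)).support,
      ∃ x' a', y.2 = encode ⟨Summary.ofStream C es, x', a'⟩ := by
  induction k generalizing x a with
  | zero =>
    intro y hy
    rw [WalkStreamAlg.emit, PMF.mem_support_pure_iff] at hy
    exact ⟨x, a, by rw [hy]⟩
  | succ k ih =>
    intro y hy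
    rw [WalkStreamAlg.emit, step_walkAlg, PMF.bind_map, PMF.mem_support_bind_iff] at hy
    obtain ⟨z, -, hz⟩ := hy
    rw [Function.comp_apply, PMF.mem_support_map_iff] at hz
    obtain ⟨y', hy', rfl⟩ := hz
    exact ih _ _ y' hy'

theorem query_walkAlg (es : List (Sym2 (Fin n))) (x s : Fin n) (a : Samples n C) :
    (walkAlg n C).query (encode ⟨Summary.ofStream C es, x, a⟩) s =
      PMF.pure (encode ⟨Summary.ofStream C es, s, a⟩) := by
  simp only [walkAlg, decode_encode]

theorem output_walkAlg (es : List (Sym2 (Fin n))) (s : Fin n) (t : ℕ) :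
    (walkAlg n C).output es s t =
      ((PMF.pi fun p : Fin n × Fin C => PMF.sampleLaw (Summary.residual C es p.1)).bind
        (walkLaw (Summary.ofStream C es) t s)).map (Fin.cons s) := by
  rw [WalkStreamAlg.output, WalkStreamAlg.run, readFrom_walkAlg, PMF.bind_map, PMF.map_comp,
    PMF.map_bind, PMF.map_bind]
  congr 1
  funext a
  rw [Function.comp_apply, query_walkAlg, PMF.pure_bind, ← emit_walkAlg_map_fst, PMF.map_comp]
  rfl

theorem wordsBounded_walkAlg (t : ℕ) : (walkAlg n C).WordsBounded t 2 := by
  have hlt : ∀ (es : List (Sym2 (Fin n))) (x : Fin n) (a : Samples n C) (i),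
      encode ⟨Summary.ofStream C es, x, a⟩ i < (max 2 (max n es.length)) ^ 2 := fun es x a i =>
    (encode_le es x a i).trans_lt (lt_self_pow₀ (lt_of_lt_of_le one_lt_two (le_max_left _ _))
      one_lt_two)
  refine fun es => ⟨fun M hM i => ?_, fun s k _ y hy i => ?_⟩
  · rw [readFrom_walkAlg, PMF.mem_support_map_iff] at hM
    obtain ⟨a, -, rfl⟩ := hM
    exact hlt es 0 a i
  · rw [WalkStreamAlg.run, readFrom_walkAlg, PMF.mem_support_map_iff] at hy
    obtain ⟨y', hy', rfl⟩ := hy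
    rw [PMF.bind_map, PMF.mem_support_bind_iff] at hy'
    obtain ⟨a, -, ha⟩ := hy'
    rw [Function.comp_apply, query_walkAlg, PMF.pure_bind] at ha
    obtain ⟨x', a', h⟩ := exists_encode_of_mem_support_emit es k s a y' ha
    change y'.2 i < _
    rw [h]
    exact hlt es x' a' i

end Algorithm

/-! ### Accuracy of the algorithm -/

namespace PMF

variable {α β : Type*} [Fintype α]

/-- The expectation of a function of a random variable with finitely many values. -/
def mean (p : PMF α) (F : α → ℝ) : ℝ := ∑ a, (p a).toReal * F a

theorem mean_mono {p : PMF α} {F G : α → ℝ} (h : ∀ a, p a ≠ 0 → F a ≤ G a) :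
    p.mean F ≤ p.mean G := by
  refine Finset.sum_le_sum fun a _ => ?_
  by_cases ha : p a = 0
  · simp [ha]
  · exact mul_le_mul_of_nonneg_left (h a ha) ENNReal.toReal_nonneg

theorem mean_add (p : PMF α) (F G : α → ℝ) : p.mean (fun a => F a + G a) = p.mean F + p.mean G := by
  simp only [mean, mul_add, Finset.sum_add_distrib]

theorem mean_const_mul (p : PMF α) (c : ℝ) (F : α → ℝ) :
    p.mean (fun a => c * F a) = c * p.mean F := by
  simp only [mean, Finset.mul_sum]
  exact Finset.sum_congr rfl fun a _ => by ring

theorem mean_nonneg (p : PMF α) {F : α → ℝ} (h : ∀ a, 0 ≤ F a) : 0 ≤ p.mean F :=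
  Finset.sum_nonneg fun a _ => mul_nonneg ENNReal.toReal_nonneg (h a)

variable [Fintype β]

theorem mean_bind (p : PMF α) (f : α → PMF β) (F : β → ℝ) :
    (p.bind f).mean F = p.mean fun a => (f a).mean F := by
  simp only [mean, bind_apply_toReal, Finset.sum_mul, Finset.mul_sum]
  rw [Finset.sum_comm]
  exact Finset.sum_congr rfl fun a _ => Finset.sum_congr rfl fun b _ => by ring

theorem mean_map (p : PMF α) (f : α → β) (F : β → ℝ) :
    (p.map f).mean F = p.mean fun a => F (f a) := by
  classical
  rw [← bind_pure_comp, mean_bind]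
  refine Finset.sum_congr rfl fun a _ => ?_
  congr 1
  simp [mean, pure_apply, apply_ite ENNReal.toReal]

end PMF

theorem map_cons_apply_toReal {n T : ℕ} (p : PMF (Fin T → Fin n)) (v : Fin n)
    (w : Fin (T + 1) → Fin n) :
    (p.map (Fin.cons (α := fun _ => Fin n) v) w).toReal =
      if w 0 = v then (p (Fin.tail w)).toReal else 0 := by
  rw [PMF.map_apply_toReal]
  split_ifs with h
  · subst h
    rw [Finset.sum_eq_single (Fin.tail w)]
    · rw [if_pos (Fin.cons_self_tail w).symm]
    · intro b _ hb
      rw [if_neg]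
      intro hw
      exact hb (by rw [hw, Fin.tail_cons])
    · simp
  · refine Finset.sum_eq_zero fun b _ => if_neg ?_
    intro hw
    exact h (by rw [hw, Fin.cons_zero])

section Accuracy

variable {n C : ℕ}

/-- The law of the samples when of those of `u` the first `k u` are unused and independent with law
`sampleLaw (r u)`, and the others are used. -/
def unusedSamples (C : ℕ) (r : Fin n → Fin n → ℕ) (k : Fin n → ℕ) : PMF (Samples n C) :=
  PMF.pi fun p => if (p.2 : ℕ) < k p.1 then PMF.sampleLaw (r p.1) else PMF.pure none

theorem unusedSamples_const (r : Fin n → Fin n → ℕ) :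
    unusedSamples C r (fun _ => C) = PMF.pi fun p => PMF.sampleLaw (r p.1) := by
  simp [unusedSamples]

theorem unusedSamples_eq_bind (r : Fin n → Fin n → ℕ) (k : Fin n → ℕ) (x : Fin n) (j : Fin C)
    (hj : k x = j + 1) :
    unusedSamples C r k = (unusedSamples C r (Function.update k x (k x - 1))).bind fun a =>
      (PMF.sampleLaw (r x)).map fun b => Function.update a (x, j) b := by
  rw [unusedSamples, unusedSamples, ← PMF.pi_update]
  congr 1
  funext ⟨y, i⟩
  by_cases hy : y = x
  · subst hy
    by_cases hi : i = j
    · subst hi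
      simp [hj]
    · have hi' : (i : ℕ) ≠ j := fun h => hi (Fin.ext h)
      rw [Function.update_of_ne (by simpa using hi)]
      simp only [hj, Function.update_self]
      congr 1
      simp only [eq_iff_iff]
      omega
  · rw [Function.update_of_ne (by simp [hy])]
    simp only [Function.update_of_ne hy]

theorem unusedSamples_eq_none {r : Fin n → Fin n → ℕ} {k : Fin n → ℕ} {a : Samples n C}
    (ha : unusedSamples C r k a ≠ 0) {x : Fin n} {j : Fin C} (hj : k x ≤ j) : a (x, j) = none := by
  rw [unusedSamples, PMF.pi_apply, Finset.prod_ne_zero_iff] at ha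
  have h := ha (x, j) (Finset.mem_univ _)
  rw [if_neg (not_lt.2 hj)] at h
  exact (PMF.mem_support_pure_iff _ _).1 h

theorem popSample_update {a : Samples n C} {x : Fin n} {j : Fin C} (v : Fin n)
    (ha : ∀ i, j ≤ i → a (x, i) = none) :
    popSample x (Function.update a (x, j) (some v)) = (v, a) := by
  have hne : (Finset.univ.filter fun i =>
      Function.update a (x, j) (some v) (x, i) ≠ none).Nonempty := ⟨j, by simp⟩
  have hmax : Finset.max' _ hne = j := by
    refine le_antisymm (Finset.max'_le _ _ _ fun i hi => ?_) (Finset.le_max' _ _ (by simp))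
    by_contra hij
    have hji : j < i := not_le.1 hij
    rw [Finset.mem_filter, Function.update_of_ne (by simpa using hji.ne')] at hi
    exact hi.2 (ha i hji.le)
  rw [popSample, dif_pos hne, hmax, Function.update_self, Function.update_idem,
    ← ha j le_rfl, Function.update_eq_self]
  rfl

theorem sum_stepChoice_weights (es : List (Sym2 (Fin n))) (x : Fin n) :
    ∑ o : Option (Fin n), (o.elim ((Summary.ofStream C es).residualDeg x)
      ((Summary.ofStream C es).stored x) : ℕ) = vertexDegree es x := by
  rw [Fintype.sum_option, vertexDegree, ← Summary.sum_residual]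
  simp only [← Summary.stored_add_residual C es, Finset.sum_add_distrib, Option.elim]
  exact add_comm _ _

/-- The two ways in which the next vertex of the output can be `w 0`. -/
theorem le_walkLaw_succ (es : List (Sym2 (Fin n))) (T : ℕ) (x : Fin n) (a : Samples n C)
    (w : Fin (T + 1) → Fin n) (hx : vertexDegree es x ≠ 0) :
    ((Summary.ofStream C es).stored x (w 0) : ℝ) / vertexDegree es x *
        (walkLaw (Summary.ofStream C es) T (w 0) a (Fin.tail w)).toReal +
      ((Summary.ofStream C es).residualDeg x : ℝ) / vertexDegree es x *
        (if w 0 = (popSample x a).1 then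
          (walkLaw (Summary.ofStream C es) T (w 0) (popSample x a).2 (Fin.tail w)).toReal else 0) ≤
      (walkLaw (Summary.ofStream C es) (T + 1) x a w).toReal := by
  have hd := sum_stepChoice_weights (C := C) es x
  have hc : ∀ o, (stepChoice (Summary.ofStream C es) x o).toReal =
      (o.elim ((Summary.ofStream C es).residualDeg x) ((Summary.ofStream C es).stored x) : ℕ) /
        (vertexDegree es x : ℝ) := fun o => by
    rw [stepChoice, PMF.ofWeights_apply_toReal (hd ▸ hx), hd]
  rw [walkLaw, walkStep, PMF.bind_map, PMF.bind_apply_toReal, Fintype.sum_option, add_comm]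
  simp only [Function.comp_apply, map_cons_apply_toReal, Option.elim, hc]
  refine add_le_add (le_of_eq ?_) ?_
  · split_ifs with h
    · rw [← h]
    · rfl
  · simp

theorem cast_vertexDegree (es : List (Sym2 (Fin n))) (x : Fin n) :
    ∑ v, (((Summary.ofStream C es).stored x v : ℝ) + Summary.residual C es x v) =
      vertexDegree es x := by
  rw [vertexDegree, Nat.cast_sum]
  exact Finset.sum_congr rfl fun v _ => by exact_mod_cast Summary.stored_add_residual C es x v

/-- As long as unused samples remain, the output follows the random walk: the samples that the
output has not used yet stay independent of it. -/
theorem budgetedWalk_le_mean_walkLaw (es : List (Sym2 (Fin n))) (T : ℕ) (x : Fin n)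
    (k : Fin n → ℕ) (hk : ∀ u, k u ≤ C) (w : Fin T → Fin n) :
    budgetedWalk (fun u v => ((Summary.ofStream C es).stored u v : ℝ))
        (fun u v => (Summary.residual C es u v : ℝ)) T x k w ≤
      (unusedSamples C (Summary.residual C es) k).mean
        fun a => (walkLaw (Summary.ofStream C es) T x a w).toReal := by
  induction T generalizing x k with
  | zero =>
    have hw : w = Fin.elim0 := Subsingleton.elim _ _
    simp [budgetedWalk, walkLaw, PMF.mean, hw, PMF.sum_toReal]
  | succ T ih =>
    rw [budgetedWalk, cast_vertexDegree]
    by_cases hx : vertexDegree es x = 0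
    · simp only [hx, Nat.cast_zero, div_zero, zero_mul, add_zero]
      exact PMF.mean_nonneg _ fun a => ENNReal.toReal_nonneg
    refine le_trans ?_ (PMF.mean_mono fun a _ => le_walkLaw_succ es T x a w hx)
    rw [PMF.mean_add, PMF.mean_const_mul, PMF.mean_const_mul]
    refine add_le_add (mul_le_mul_of_nonneg_left (ih _ k hk _) (by positivity)) ?_
    by_cases hkx : k x = 0
    · rw [if_pos hkx, mul_zero]
      exact mul_nonneg (by positivity)
        (PMF.mean_nonneg _ fun a => by split_ifs <;> simp)
    rw [if_neg hkx]
    by_cases hR : ∑ v, Summary.residual C es x v = 0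
    · have h0 : Summary.residual C es x (w 0) = 0 :=
        Finset.sum_eq_zero_iff.1 hR (w 0) (Finset.mem_univ _)
      rw [h0, Nat.cast_zero, zero_div, zero_mul]
      exact mul_nonneg (by positivity)
        (PMF.mean_nonneg _ fun a => by split_ifs <;> simp)
    have hkC := hk x
    obtain ⟨j, hj⟩ : ∃ j : Fin C, k x = j + 1 := ⟨⟨k x - 1, by omega⟩, by simp only; omega⟩
    set k' := Function.update k x (k x - 1) with hk'
    have hk'C : ∀ u, k' u ≤ C := by
      intro u
      by_cases hu : u = x
      · subst hu
        rw [hk', Function.update_self]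
        omega
      · rw [hk', Function.update_of_ne hu]
        exact hk u
    have hR' : ((∑ v, Summary.residual C es x v : ℕ) : ℝ) ≠ 0 := by exact_mod_cast hR
    rw [unusedSamples_eq_bind _ k x j hj, PMF.mean_bind, ← hk']
    have hpop : ∀ a, unusedSamples C (Summary.residual C es) k' a ≠ 0 →
        (Summary.residual C es x (w 0) : ℝ) / (∑ v, Summary.residual C es x v : ℕ) *
          (walkLaw (Summary.ofStream C es) T (w 0) a (Fin.tail w)).toReal ≤
        ((PMF.sampleLaw (Summary.residual C es x)).map fun b => Function.update a (x, j) b).mean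
          fun a => if w 0 = (popSample x a).1 then
            (walkLaw (Summary.ofStream C es) T (w 0) (popSample x a).2 (Fin.tail w)).toReal
            else 0 := by
      intro a ha
      have hnone : ∀ i, j ≤ i → a (x, i) = none := fun i hi =>
        unusedSamples_eq_none ha (by
          rw [hk', Function.update_self, hj, Nat.add_sub_cancel]
          exact hi)
      rw [PMF.mean_map, PMF.mean]
      refine le_trans (le_of_eq ?_) (Finset.single_le_sum
        (fun o _ => mul_nonneg ENNReal.toReal_nonneg (by split_ifs <;> simp))
        (Finset.mem_univ (some (w 0))))
      simp only [popSample_update (w 0) hnone, if_true, PMF.sampleLaw_apply_toReal hR, Option.elim]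
    refine le_trans ?_ (mul_le_mul_of_nonneg_left (PMF.mean_mono hpop) (by positivity))
    rw [PMF.mean_const_mul, ← Summary.sum_residual, ← mul_assoc,
      div_mul_div_comm, mul_comm (_ : ℝ) (Summary.residual C es x (w 0) : ℝ),
      mul_div_mul_right _ _ hR']
    exact mul_le_mul_of_nonneg_left (ih _ k' hk'C _) (by positivity)

end Accuracy

section RandomWalk

variable {n : ℕ}

theorem randomWalkLaw_cons_succ (es : List (Sym2 (Fin n))) (T : ℕ) (x : Fin n)
    (w : Fin (T + 1) → Fin n) :
    randomWalkLaw es x (T + 1) (Fin.cons x w) =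
      (edgeMult es x (w 0) : ℝ) / vertexDegree es x * randomWalkLaw es (w 0) T w := by
  rw [randomWalkLaw, randomWalkLaw, if_pos (Fin.cons_zero _ _), if_pos rfl, Fin.prod_univ_succ]
  rfl

theorem randomWalkLaw_nonneg (es : List (Sym2 (Fin n))) (T : ℕ) (x : Fin n)
    (w : Fin (T + 1) → Fin n) : 0 ≤ randomWalkLaw es x T w := by
  rw [randomWalkLaw]
  split_ifs
  · exact Finset.prod_nonneg fun i _ => by positivity
  · exact le_rfl

theorem sum_randomWalkLaw_le_one (es : List (Sym2 (Fin n))) (T : ℕ) (x : Fin n) :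
    ∑ w, randomWalkLaw es x T (Fin.cons x w) ≤ 1 := by
  induction T generalizing x with
  | zero => simp [randomWalkLaw]
  | succ T ih =>
    simp only [randomWalkLaw_cons_succ]
    rw [Fin.sum_univ_pi_succ]
    simp only [Fin.cons_zero, ← Finset.mul_sum]
    calc ∑ v, (edgeMult es x v : ℝ) / vertexDegree es x *
          ∑ w : Fin T → Fin n, randomWalkLaw es v T (Fin.cons v w)
        ≤ ∑ v, (edgeMult es x v : ℝ) / vertexDegree es x * 1 :=
          Finset.sum_le_sum fun v _ => mul_le_mul_of_nonneg_left (ih v) (by positivity)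
      _ ≤ 1 := by
          simp only [mul_one]
          rw [← Finset.sum_div, ← Nat.cast_sum]
          exact div_self_le_one _

theorem budgetedWalk_le_randomWalkLaw {C : ℕ} (es : List (Sym2 (Fin n))) (T : ℕ) (x : Fin n)
    (k : Fin n → ℕ) (w : Fin T → Fin n) :
    budgetedWalk (fun u v => ((Summary.ofStream C es).stored u v : ℝ))
        (fun u v => (Summary.residual C es u v : ℝ)) T x k w ≤
      randomWalkLaw es x T (Fin.cons x w) := by
  induction T generalizing x k with
  | zero => simp [budgetedWalk, randomWalkLaw]
  | succ T ih =>
    have ih' := fun k => ih (w 0) k (Fin.tail w)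
    rw [Fin.cons_self_tail] at ih'
    rw [budgetedWalk, cast_vertexDegree, randomWalkLaw_cons_succ,
      ← Summary.stored_add_residual C es, Nat.cast_add, add_div, add_mul]
    refine add_le_add (mul_le_mul_of_nonneg_left (ih' k) (by positivity))
      (mul_le_mul_of_nonneg_left ?_ (by positivity))
    split_ifs
    · exact randomWalkLaw_nonneg es T (w 0) w
    · exact ih' _

/-- The law of the output and that of the random walk both dominate the law of the walk whose
residual steps stay within the number `C` of samples, so their distance is at most twice the mass
that is missing from it. -/
theorem sum_abs_output_sub_le {C : ℕ} [NeZero n] (es : List (Sym2 (Fin n))) (s : Fin n)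
    (hs : 0 < vertexDegree es s) (t : ℕ) :
    ∑ w : Fin (t + 1) → Fin n,
        |((walkAlg n C).output es s t w).toReal - randomWalkLaw es s t w| ≤
      2 * ((t.choose (C + 1) : ℝ) / ((C + 1 : ℕ) : ℝ) ^ C) := by
  set Q := (PMF.pi fun p : Fin n × Fin C => PMF.sampleLaw (Summary.residual C es p.1)).bind
    (walkLaw (Summary.ofStream C es) t s) with hQ
  set B : (Fin t → Fin n) → ℝ :=
    budgetedWalk (fun u v => ((Summary.ofStream C es).stored u v : ℝ))
      (fun u v => (Summary.residual C es u v : ℝ)) t s (fun _ => C) with hB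
  have hBQ : ∀ w, B w ≤ (Q w).toReal := by
    intro w
    have h := budgetedWalk_le_mean_walkLaw es t s (fun _ => C) (fun _ => le_rfl) w
    rw [unusedSamples_const] at h
    rw [hQ, PMF.bind_apply_toReal]
    exact h
  have hBR : ∀ w, B w ≤ randomWalkLaw es s t (Fin.cons s w) := fun w =>
    budgetedWalk_le_randomWalkLaw es t s _ w
  have hloss : 1 - ∑ w, B w ≤ (t.choose (C + 1) : ℝ) / ((C + 1 : ℕ) : ℝ) ^ C := by
    refine one_sub_sum_budgetedWalk_const_le (fun _ _ => Nat.cast_nonneg _)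
      (fun _ _ => Nat.cast_nonneg _) (fun u v => ?_) (Nat.cast_nonneg _) (fun u v => ?_) t C ?_
    · have h1 := Summary.stored_add_residual C es u v
      have h2 := Summary.stored_add_residual C es v u
      rw [edgeMult_comm] at h2
      exact_mod_cast h1.trans h2.symm
    · rw [cast_vertexDegree, le_div_iff₀ (by positivity), mul_comm]
      exact_mod_cast Summary.mul_residual_le C es u v
    · rw [cast_vertexDegree]
      exact_mod_cast hs
  have hother : ∀ u, u ≠ s → ∀ w : Fin t → Fin n,
      |((walkAlg n C).output es s t (Fin.cons u w)).toReal - randomWalkLaw es s t (Fin.cons u w)|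
        = 0 := by
    intro u hu w
    rw [output_walkAlg, map_cons_apply_toReal, randomWalkLaw, Fin.cons_zero, if_neg hu, if_neg hu]
    simp
  rw [Fin.sum_univ_pi_succ, Finset.sum_eq_single s
    (fun u _ hu => Finset.sum_eq_zero fun w _ => hother u hu w) (by simp)]
  calc ∑ w : Fin t → Fin n,
        |((walkAlg n C).output es s t (Fin.cons s w)).toReal - randomWalkLaw es s t (Fin.cons s w)|
      ≤ ∑ w, (((Q w).toReal - B w) + (randomWalkLaw es s t (Fin.cons s w) - B w)) := by
        refine Finset.sum_le_sum fun w _ => ?_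
        rw [output_walkAlg, map_cons_apply_toReal, if_pos (Fin.cons_zero _ _), Fin.tail_cons,
          abs_le]
        have h1 := hBQ w
        have h2 := hBR w
        constructor <;> linarith
    _ = ∑ w, (Q w).toReal + ∑ w, randomWalkLaw es s t (Fin.cons s w) - 2 * ∑ w, B w := by
        rw [Finset.sum_add_distrib, Finset.sum_sub_distrib, Finset.sum_sub_distrib]
        ring
    _ ≤ 2 * (1 - ∑ w, B w) := by
        have h1 := Q.sum_toReal
        have h2 := sum_randomWalkLaw_le_one es t s
        linarith
    _ ≤ _ := by linarith

end RandomWalk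

/-! ### The number of samples -/

theorem two_le_qParam {t : ℕ} {ε : ℝ} (hε : 0 < ε) (hε1 : ε ≤ 1) : 2 ≤ qParam t ε := by
  have h : 0 ≤ Real.logb 2 (1 / ε) := Real.logb_nonneg one_lt_two (one_le_one_div hε hε1)
  have := div_nonneg h (Real.sqrt_nonneg t)
  rw [qParam]
  linarith

theorem logb_two_le_mul_sqrt {q : ℝ} (hq : 0 < q) : Real.logb 2 q ≤ 3 * √q := by
  have h1 : Real.log √q ≤ √q - 1 := Real.log_le_sub_one_of_pos (Real.sqrt_pos.2 hq)
  rw [Real.log_sqrt hq.le] at h1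
  rw [Real.logb, div_le_iff₀ (Real.log_pos one_lt_two)]
  nlinarith [Real.log_two_gt_d9, Real.sqrt_nonneg q]

theorem natCast_pow_self_le (N : ℕ) : (N : ℝ) ^ N ≤ 3 ^ N * N.factorial := by
  have h1 := Real.pow_div_factorial_le_exp (N : ℝ) (Nat.cast_nonneg N) N
  have h2 : Real.exp N ≤ 3 ^ N := by
    rw [← mul_one (N : ℝ), Real.exp_nat_mul]
    exact pow_le_pow_left₀ (Real.exp_pos 1).le (by linarith [Real.exp_one_lt_d9]) N
  rw [← div_le_iff₀ (by positivity)]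
  exact h1.trans h2

theorem two_mul_le_four_pow {N : ℕ} (hN : 1 ≤ N) : 2 * N ≤ 4 ^ N := by
  have h1 : N ≤ 2 ^ N := Nat.lt_two_pow_self.le
  have h2 : 2 ≤ 2 ^ N := Nat.le_self_pow (by omega) 2
  calc 2 * N ≤ 2 ^ N * 2 ^ N := Nat.mul_le_mul h2 h1
    _ = 4 ^ N := (mul_pow 2 2 N).symm

/-- If `N² ≥ 12 t q`, then the overflow bound for `N - 1` samples is at most `q ^ (-N)`. -/
theorem two_mul_choose_div_le (t C : ℕ) {q : ℝ} (hq : 0 < q)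
    (h : 12 * t * q ≤ ((C + 1 : ℕ) : ℝ) ^ 2) :
    2 * ((t.choose (C + 1) : ℝ) / ((C + 1 : ℕ) : ℝ) ^ C) ≤ 1 / q ^ (C + 1) := by
  have hN : 1 ≤ C + 1 := by omega
  have hsplit : ((C + 1 : ℕ) : ℝ) ^ (C + 1) = ((C + 1 : ℕ) : ℝ) ^ C * ((C + 1 : ℕ) : ℝ) := pow_succ _ _
  have hNpos : (0 : ℝ) < ((C + 1 : ℕ) : ℝ) := by positivity
  generalize hNC : C + 1 = N at *
  have hN4 : (2 * N : ℝ) ≤ 4 ^ N := by exact_mod_cast two_mul_le_four_pow hN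
  have hchoose : (t.choose N : ℝ) ≤ (t : ℝ) ^ N / N.factorial := Nat.choose_le_pow_div N t
  have hfac : (0 : ℝ) < N.factorial := by positivity
  have hNN : (0 : ℝ) < (N : ℝ) ^ N := by positivity
  rw [le_div_iff₀ hfac] at hchoose
  have hpow : (12 * t * q : ℝ) ^ N ≤ (N : ℝ) ^ N * (N : ℝ) ^ N := by
    rw [← pow_add, ← two_mul, pow_mul]
    exact pow_le_pow_left₀ (by positivity) h N
  have e1 : 2 * ((t.choose N : ℝ) / (N : ℝ) ^ C) = 2 * N * t.choose N / (N : ℝ) ^ N := by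
    rw [hsplit]
    field_simp
  rw [e1, div_le_div_iff₀ hNN (by positivity), one_mul]
  refine le_of_mul_le_mul_right ?_ hNN
  calc 2 * N * t.choose N * q ^ N * (N : ℝ) ^ N
      ≤ 4 ^ N * t.choose N * q ^ N * (3 ^ N * N.factorial) := by
        gcongr
        exact natCast_pow_self_le N
    _ = 4 ^ N * 3 ^ N * q ^ N * (t.choose N * N.factorial) := by ring
    _ ≤ 4 ^ N * 3 ^ N * q ^ N * (t : ℝ) ^ N := by gcongr
    _ = (12 * t * q : ℝ) ^ N := by
        rw [← mul_pow, ← mul_pow, ← mul_pow]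
        congr 1
        ring
    _ ≤ (N : ℝ) ^ N * (N : ℝ) ^ N := hpow

/-- Since `log₂ q ≤ 3 √q`, a number `N ≥ 11 √t q / log₂ q` satisfies `N² ≥ 12 t q`, and on the other
hand `q ^ N ≥ 2 ^ (11 √t q) ≥ 1 / ε`. -/
theorem two_mul_choose_div_le_of_le {t C : ℕ} {ε : ℝ} (ht : 1 ≤ t) (hε : 0 < ε) (hε1 : ε ≤ 1)
    (hC : 11 * (√(t : ℝ) * (qParam t ε / Real.logb 2 (qParam t ε))) ≤ ((C + 1 : ℕ) : ℝ)) :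
    2 * ((t.choose (C + 1) : ℝ) / ((C + 1 : ℕ) : ℝ) ^ C) ≤ ε := by
  have hq2 := two_le_qParam (t := t) hε hε1
  have hst : 0 < √(t : ℝ) := Real.sqrt_pos.2 (by exact_mod_cast ht)
  have hlogε : Real.logb 2 (1 / ε) = (qParam t ε - 2) * √(t : ℝ) := by
    rw [qParam]
    field_simp
    ring
  generalize qParam t ε = q at *
  have hq : 0 < q := by linarith
  have hL : 0 < Real.logb 2 q := Real.logb_pos one_lt_two (by linarith)
  have hsq : 0 < √q := Real.sqrt_pos.2 hq
  have hx : √q / 3 ≤ q / Real.logb 2 q := by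
    rw [div_le_div_iff₀ (by norm_num) hL]
    calc √q * Real.logb 2 q ≤ √q * (3 * √q) :=
          mul_le_mul_of_nonneg_left (logb_two_le_mul_sqrt hq) hsq.le
      _ = 3 * (√q * √q) := by ring
      _ = q * 3 := by rw [Real.mul_self_sqrt hq.le, mul_comm]
  have hN : 11 * (√(t : ℝ) * (√q / 3)) ≤ ((C + 1 : ℕ) : ℝ) := le_trans (by gcongr) hC
  refine (two_mul_choose_div_le t C hq ?_).trans ?_
  · calc 12 * t * q ≤ (11 / 3) ^ 2 * (t * q) := by
          have : 0 ≤ t * q := by positivity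
          nlinarith
      _ = (11 * (√(t : ℝ) * (√q / 3))) ^ 2 := by
          rw [mul_pow, mul_pow, div_pow √q, Real.sq_sqrt (Nat.cast_nonneg t), Real.sq_sqrt hq.le]
          ring
      _ ≤ _ := pow_le_pow_left₀ (by positivity) hN 2
  · rw [one_div_le (by positivity) hε]
    have hexp : Real.logb 2 (1 / ε) ≤ Real.logb 2 q * ((C + 1 : ℕ) : ℝ) := by
      have h1 := mul_le_mul_of_nonneg_left hC hL.le
      have h2 : Real.logb 2 q * (11 * (√(t : ℝ) * (q / Real.logb 2 q))) = 11 * (√(t : ℝ) * q) := by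
        field_simp
      rw [hlogε]
      nlinarith [mul_pos hst hq]
    calc 1 / ε = (2 : ℝ) ^ Real.logb 2 (1 / ε) :=
          (Real.rpow_logb two_pos (by norm_num) (by positivity)).symm
      _ ≤ (2 : ℝ) ^ (Real.logb 2 q * ((C + 1 : ℕ) : ℝ)) :=
          Real.rpow_le_rpow_of_exponent_le one_le_two hexp
      _ = q ^ (C + 1) := by
          rw [Real.rpow_mul two_pos.le, Real.rpow_logb two_pos (by norm_num) hq, Real.rpow_natCast]

theorem memSize_le {n t : ℕ} {ε : ℝ} (hn : 1 ≤ n) (ht : 1 ≤ t) (hε : 0 < ε) (hε1 : ε ≤ 1) :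
    (memSize n ⌈11 * (√(t : ℝ) * (qParam t ε / Real.logb 2 (qParam t ε)))⌉₊ : ℝ) ≤
      48 * (n * √(t : ℝ) * (qParam t ε / Real.logb 2 (qParam t ε))) := by
  have hq2 := two_le_qParam (t := t) hε hε1
  generalize qParam t ε = q at *
  have hq : 0 < q := by linarith
  have hL : 0 < Real.logb 2 q := Real.logb_pos one_lt_two (by linarith)
  have hst : 1 ≤ √(t : ℝ) := Real.one_le_sqrt.2 (by exact_mod_cast ht)
  have hx : 1 / 3 ≤ q / Real.logb 2 q := by
    rw [div_le_div_iff₀ (by norm_num) hL]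
    have h1 : 1 ≤ √q := Real.one_le_sqrt.2 (by linarith)
    nlinarith [logb_two_le_mul_sqrt hq, Real.mul_self_sqrt hq.le]
  have hy : 1 / 3 ≤ √(t : ℝ) * (q / Real.logb 2 q) := by nlinarith
  rw [memSize_eq, mul_assoc]
  generalize √(t : ℝ) * (q / Real.logb 2 q) = y at *
  have hceil := (Nat.ceil_lt_add_one (show 0 ≤ 11 * y by linarith)).le
  have hn' : (1 : ℝ) ≤ n := by exact_mod_cast hn
  push_cast
  nlinarith

theorem qParam_div_logb_le {t : ℕ} {ε b : ℝ} (ht : 1 ≤ t) (hε : 0 < ε) (hε1 : ε ≤ 1)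
    (hb : (2 : ℝ) ^ (-(b * √(t : ℝ))) ≤ ε) :
    qParam t ε / Real.logb 2 (qParam t ε) ≤ 2 + b := by
  have hq2 := two_le_qParam (t := t) hε hε1
  have hst : 0 < √(t : ℝ) := Real.sqrt_pos.2 (by exact_mod_cast ht)
  have h1 : Real.logb 2 (1 / ε) ≤ b * √(t : ℝ) := by
    rw [Real.logb_le_iff_le_rpow one_lt_two (by positivity), one_div_le hε (by positivity), one_div,
      ← Real.rpow_neg two_pos.le]
    exact hb
  have h2 : 1 ≤ Real.logb 2 (qParam t ε) := by
    rw [Real.le_logb_iff_rpow_le one_lt_two (by linarith), Real.rpow_one]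
    exact hq2
  refine (div_le_self (by linarith) h2).trans ?_
  rw [qParam]
  have := (div_le_iff₀ hst).2 h1
  linarith

end

theorem theorem4 :
    ∃ (c : ℕ) (K : ℝ) (K' : ℝ → ℝ),
      ∀ (n t : ℕ) (ε : ℝ), 1 ≤ n → 1 ≤ t → 0 < ε → ε ≤ 1 →
        ∃ (S : ℕ) (A : WalkStreamAlg n S),
          A.SimulatesWithin t ε ∧
          A.WordsBounded t c ∧
          (S : ℝ) ≤ K * (n * √(t : ℝ) * (qParam t ε / Real.logb 2 (qParam t ε))) ∧
          ∀ b : ℝ, (2 : ℝ) ^ (-(b * √(t : ℝ))) ≤ ε → (S : ℝ) ≤ K' b * (n * √(t : ℝ)) := by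
  -- A word is at most `max 2 (max n m)`, hence smaller than its square.
  refine ⟨2, 48, fun b => 48 * (2 + b), fun n t ε hn ht hε hε1 => ?_⟩
  have : NeZero n := ⟨by omega⟩
  have hmem := memSize_le hn ht hε hε1
  refine ⟨_, walkAlg n ⌈11 * (√(t : ℝ) * (qParam t ε / Real.logb 2 (qParam t ε)))⌉₊,
    fun es s hs => ?_, wordsBounded_walkAlg t, hmem, fun b hb => hmem.trans ?_⟩
  · refine (sum_abs_output_sub_le es s hs t).trans (two_mul_choose_div_le_of_le ht hε hε1 ?_)
    refine (Nat.le_ceil _).trans ?_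
    exact_mod_cast Nat.le_succ _
  · have h := mul_le_mul_of_nonneg_left (qParam_div_logb_le ht hε hε1 hb)
      (by positivity : (0 : ℝ) ≤ n * √(t : ℝ))
    calc 48 * (n * √(t : ℝ) * (qParam t ε / Real.logb 2 (qParam t ε)))
        ≤ 48 * (n * √(t : ℝ) * (2 + b)) := by linarith
      _ = 48 * (2 + b) * (n * √(t : ℝ)) := by ring
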